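/- Notation. For $z=(x,\xi)\in\mathbb{R}^2$ and $g:\mathbb{R}\to\mathbb{C}$ put $\pi(z)g(t)=e^{2\pi i t\xi}g(t-x)$. Write $\langle f,g\rangle=\int_{\mathbb{R}}f\,\overline{g}\,dt$. If $f\in\mathcal{S}'(\mathbb{R})$ is a tempered distribution and $g$ is a Schwartz function, then $\langle f,g\rangle:=f(\overline{g})$. The short-time Fourier transform and its kernel are $V_gf(z)=\langle f,\pi(z)g\rangle$ and $K_g(z,w)=\langle \pi(w)g,\pi(z)g\rangle$. The Hermite functions are $$h_r(t)=\frac{2^{1/4}}{\sqrt{r!}}\Big(\frac{-1}{2\sqrt{\pi}}\Big)^{r}e^{\pi t^2}\frac{d^r}{dt^r}\big(e^{-2\pi t^2}\big),\qquad r\in\mathbb{N}_0.$$ Let $L_j^0$ be the Laguerre polynomials, given by $L^0_0=1$, $L^0_1(x)=1-x$ and $L^0_{j+1}(x)=\frac{2j+1-x}{j+1}L^0_j(x)-\frac{j}{j+1}L^0_{j-1}(x)$ for $j\ge 1$. Let $D_R\subset\mathbb{R}^2$ be the Euclidean disc of radius $R$ centred at $0$. Theorem (local reproducing formula for Hermite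 windows). Let $R>0$ and $r,j\in\mathbb{N}_0$, and put $$C_{j,r}(R):=\langle \chi_{D_R}V_{h_r}h_r,\,V_{h_j}h_j\rangle_{L^2(\mathbb{R}^2)} .$$ The integral that defines this inner product converges absolutely, and $$C_{j,r}(R)=\int_0^{\pi R^2}L_r^0(t)L_j^0(t)e^{-t}\,dt .$$ For every $f\in L^2(\mathbb{R})$, and likewise for every tempered distribution $f\in\mathcal{S}'(\mathbb{R})$, and for every $z\in\mathbb{R}^2$, the function $w\mapsto V_{h_r}f(w)K_{h_j}(z,w)$ is integrable on $z+D_R$ and $$C_{j,r}(R)\,V_{h_r}f(z)=\int_{z+D_R}V_{h_r}f(w)\,K_{h_j}(z,w)\,dw .$$ Consequently, whenever $C_{j,r}(R)\neq 0$, $$V_{h_r}f(z)=C_{j,r}(R)^{-1}\int_{z+D_R}V_{h_r}f(w)\,K_{h_j}(z,w)\,dw .$$ If $j=r$, then $C_{j,r}(R)\neq0$ for every $R>0$. -/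

import Mathlib

open MeasureTheory Set
open scoped SchwartzMap ComplexConjugate ContDiff

/-! ### Time-frequency shifts and the short-time Fourier transform -/

/-- The pairing `⟨f, g⟩ = ∫ f(t) \overline{g(t)} dt`, linear in the first variable. -/
noncomputable def l2Pairing (f g : ℝ → ℂ) : ℂ :=
  ∫ t, f t * conj (g t)

/-- The time-frequency shift `π(z) g (t) = e^{2 π i t ξ} g(t - x)`, where `z = (x, ξ)`. -/
noncomputable def tfShift (z : ℝ × ℝ) (g : ℝ → ℂ) (t : ℝ) : ℂ :=
  Complex.exp (2 * Real.pi * Complex.I * t * z.2) * g (t - z.1)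

/-- The short-time Fourier transform `V_g f (z) = ⟨f, π(z) g⟩`. -/
noncomputable def stft (g f : ℝ → ℂ) (z : ℝ × ℝ) : ℂ :=
  l2Pairing f (tfShift z g)

/-- The reproducing kernel `K_g(z, w) = ⟨π(w) g, π(z) g⟩`. -/
noncomputable def stftKernel (g : ℝ → ℂ) (z w : ℝ × ℝ) : ℂ :=
  l2Pairing (tfShift w g) (tfShift z g)

/-- The open disc `z + D_R` of radius `R` and centre `z` in the Euclidean plane. (The type `ℝ × ℝ`
carries the sup metric, so this is not a ball of that metric.) -/
def planeDisc (z : ℝ × ℝ) (R : ℝ) : Set (ℝ × ℝ) :=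
  {w | (w.1 - z.1) ^ 2 + (w.2 - z.2) ^ 2 < R ^ 2}

/-! ### Hermite functions and Laguerre polynomials -/

/-- The Hermite function
`h_r(t) = (2^{1/4} / √(r!)) (-1 / (2 √π))^r e^{π t²} (d/dt)^r (e^{-2 π t²})`, as a real function. -/
noncomputable def hermiteReal (r : ℕ) (t : ℝ) : ℝ :=
  (2 : ℝ) ^ (1 / 4 : ℝ) / √(r.factorial : ℝ) * (-1 / (2 * √Real.pi)) ^ r *
    Real.exp (Real.pi * t ^ 2) *
    iteratedDeriv r (fun s : ℝ => Real.exp (-2 * Real.pi * s ^ 2)) t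

/-- The Hermite function `h_r`, as a complex valued function. -/
noncomputable def hermiteFun (r : ℕ) (t : ℝ) : ℂ :=
  (hermiteReal r t : ℂ)

/-- The generalized Laguerre polynomials `L_j^α`, by their three-term recurrence. -/
noncomputable def laguerreFun (α : ℝ) : ℕ → ℝ → ℝ
  | 0, _ => 1
  | 1, x => 1 + α - x
  | (j + 2), x =>
      (2 * (j + 1) + 1 + α - x) / (j + 2) * laguerreFun α (j + 1) x -
        (j + 1 + α) / (j + 2) * laguerreFun α j x

/-- The constant `C_{j,r}(R) = ⟨χ_{D_R} · V_{h_r} h_r, V_{h_j} h_j⟩`, an inner product in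
`L²(ℝ²)`. -/
noncomputable def localConst (j r : ℕ) (R : ℝ) : ℂ :=
  ∫ w, (planeDisc 0 R).indicator (stft (hermiteFun r) (hermiteFun r)) w *
    conj (stft (hermiteFun j) (hermiteFun j) w)

/-! ### The short-time Fourier transform of a tempered distribution -/

/-- Derivatives of a polynomial times a Gaussian have the same form. -/
theorem iteratedDeriv_realGaussian (n : ℕ) (a : ℝ) :
    ∃ Q : Polynomial ℝ, ∀ t : ℝ,
      iteratedDeriv n (fun s : ℝ => Real.exp (a * s ^ 2)) t = Q.eval t * Real.exp (a * t ^ 2) := by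
  induction n with
  | zero => exact ⟨1, fun t => by simp⟩
  | succ n ih =>
    obtain ⟨Q, hQ⟩ := ih
    refine ⟨Q.derivative + Q * (Polynomial.C (2 * a) * Polynomial.X), fun t => ?_⟩
    rw [iteratedDeriv_succ, funext hQ]
    have h1 : HasDerivAt (fun s : ℝ => Real.exp (a * s ^ 2))
        (Real.exp (a * t ^ 2) * (a * (2 * t))) t := by
      have h0 : HasDerivAt (fun s : ℝ => a * s ^ 2) (a * (2 * t)) t := by
        simpa using (hasDerivAt_pow 2 t).const_mul a
      exact h0.exp
    refine ((Q.hasDerivAt t).mul h1).deriv.trans ?_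
    simp
    ring

/-- Derivatives of a polynomial times a modulated and translated Gaussian have the same form. -/
theorem iteratedDeriv_complexGaussian (n : ℕ) (P : Polynomial ℂ) (a b c : ℂ) :
    ∃ Q : Polynomial ℂ, ∀ t : ℝ,
      iteratedDeriv n (fun s : ℝ => P.eval (s : ℂ) *
        Complex.exp (a * (s : ℂ) ^ 2 + b * s + c)) t =
      Q.eval (t : ℂ) * Complex.exp (a * (t : ℂ) ^ 2 + b * t + c) := by
  induction n with
  | zero => exact ⟨P, fun t => by simp⟩
  | succ n ih =>
    obtain ⟨Q, hQ⟩ := ih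
    refine ⟨Q.derivative + Q * (Polynomial.C (2 * a) * Polynomial.X + Polynomial.C b),
      fun t => ?_⟩
    rw [iteratedDeriv_succ, funext hQ]
    have h0 : HasDerivAt (fun s : ℂ => a * s ^ 2 + b * s + c) (a * (2 * t) + b) (t : ℂ) := by
      simpa using (((hasDerivAt_pow 2 (t : ℂ)).const_mul a).add
        ((hasDerivAt_id (t : ℂ)).const_mul b)).add_const c
    have h1 := ((Q.hasDerivAt (t : ℂ)).mul h0.cexp).comp_ofReal
    refine (HasDerivAt.deriv h1).trans ?_
    simp
    ring

/-- A polynomial times a Gaussian is bounded on the real line. -/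
theorem bounded_complexGaussian (P : Polynomial ℂ) (b c : ℂ) :
    ∃ C : ℝ, ∀ t : ℝ,
      ‖P.eval (t : ℂ) * Complex.exp (-Real.pi * (t : ℂ) ^ 2 + b * t + c)‖ ≤ C := by
  induction P using Polynomial.induction_on' with
  | add p q hp hq =>
    obtain ⟨C, hC⟩ := hp
    obtain ⟨D, hD⟩ := hq
    refine ⟨C + D, fun t => ?_⟩
    rw [Polynomial.eval_add, add_mul]
    exact (norm_add_le _ _).trans (add_le_add (hC t) (hD t))
  | monomial m u =>
    refine ⟨‖u‖ * ((m.factorial : ℝ) * Real.exp ((1 + |b.re|) ^ 2 + c.re)), fun t => ?_⟩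
    have hre : (-Real.pi * (t : ℂ) ^ 2 + b * t + c).re = -Real.pi * t ^ 2 + b.re * t + c.re := by
      simp [pow_two]
    rw [Polynomial.eval_monomial, norm_mul, norm_mul, Complex.norm_exp, hre, norm_pow,
      Complex.norm_real, Real.norm_eq_abs, mul_assoc]
    have h1 : |t| ^ m ≤ m.factorial * Real.exp |t| := by
      have := Real.pow_div_factorial_le_exp |t| (abs_nonneg t) m
      rwa [div_le_iff₀ (by positivity), mul_comm] at this
    have h2 : |t| + (-Real.pi * t ^ 2 + b.re * t + c.re) ≤ (1 + |b.re|) ^ 2 + c.re := by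
      have h3 : b.re * t ≤ |b.re| * |t| := by
        rw [← abs_mul]; exact le_abs_self _
      have h4 : t ^ 2 = |t| ^ 2 := (sq_abs t).symm
      rw [h4]
      nlinarith [Real.pi_gt_three, sq_nonneg (|t| - (1 + |b.re|)), sq_nonneg (|t|),
        sq_nonneg (1 + |b.re|)]
    have h5 : |t| ^ m * Real.exp (-Real.pi * t ^ 2 + b.re * t + c.re) ≤
        m.factorial * Real.exp ((1 + |b.re|) ^ 2 + c.re) :=
      calc |t| ^ m * Real.exp (-Real.pi * t ^ 2 + b.re * t + c.re)
          ≤ (m.factorial * Real.exp |t|) * Real.exp (-Real.pi * t ^ 2 + b.re * t + c.re) := by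
            gcongr
        _ = m.factorial * Real.exp (|t| + (-Real.pi * t ^ 2 + b.re * t + c.re)) := by
            rw [mul_assoc, ← Real.exp_add]
        _ ≤ _ := by gcongr
    gcongr

/-- The conjugate of a time-frequency shift of `h_r` is a polynomial times a Gaussian. -/
theorem conj_tfShift_hermiteFun (r : ℕ) (z : ℝ × ℝ) :
    ∃ (P : Polynomial ℂ) (b c : ℂ), (fun t : ℝ => conj (tfShift z (hermiteFun r) t)) =
      fun t : ℝ => P.eval (t : ℂ) * Complex.exp (-Real.pi * (t : ℂ) ^ 2 + b * t + c) := by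
  obtain ⟨Q, hQ⟩ := iteratedDeriv_realGaussian r (-2 * Real.pi)
  refine ⟨Polynomial.C ((((2 : ℝ) ^ (1 / 4 : ℝ) / √(r.factorial : ℝ) *
      (-1 / (2 * √Real.pi)) ^ r : ℝ)) : ℂ) *
      (Q.map Complex.ofRealHom).comp (Polynomial.X - Polynomial.C (z.1 : ℂ)),
    2 * Real.pi * z.1 - 2 * Real.pi * Complex.I * z.2, -Real.pi * z.1 ^ 2, ?_⟩
  funext t
  have hh : hermiteReal r (t - z.1) = (2 : ℝ) ^ (1 / 4 : ℝ) / √(r.factorial : ℝ) *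
      (-1 / (2 * √Real.pi)) ^ r * (Q.eval (t - z.1) * Real.exp (-Real.pi * (t - z.1) ^ 2)) := by
    have : Real.exp (-Real.pi * (t - z.1) ^ 2) =
        Real.exp (Real.pi * (t - z.1) ^ 2) * Real.exp (-2 * Real.pi * (t - z.1) ^ 2) := by
      rw [← Real.exp_add]; congr 1; ring
    rw [hermiteReal, hQ, this]
    ring
  have hq : (Q.map Complex.ofRealHom).eval ((t : ℂ) - z.1) = ((Q.eval (t - z.1) : ℝ) : ℂ) := by
    have := Polynomial.eval_map_apply (p := Q) (f := Complex.ofRealHom) (t - z.1)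
    simpa using this
  have he : Complex.exp (-Real.pi * (t : ℂ) ^ 2 +
      (2 * Real.pi * z.1 - 2 * Real.pi * Complex.I * z.2) * t + -Real.pi * z.1 ^ 2) =
      Complex.exp (-(2 * Real.pi * Complex.I * t * z.2)) *
        ((Real.exp (-Real.pi * (t - z.1) ^ 2) : ℝ) : ℂ) := by
    rw [Complex.ofReal_exp, ← Complex.exp_add]
    congr 1
    push_cast
    ring
  have hc : conj (Complex.exp (2 * Real.pi * Complex.I * t * z.2)) =
      Complex.exp (-(2 * Real.pi * Complex.I * t * z.2)) := by
    rw [← Complex.exp_conj]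
    simp [Complex.conj_ofNat]
  rw [tfShift, hermiteFun, map_mul, hc, Complex.conj_ofReal, hh, he]
  simp only [Polynomial.eval_mul, Polynomial.eval_C, Polynomial.eval_comp, Polynomial.eval_sub,
    Polynomial.eval_X, hq]
  push_cast
  ring

/-- The Schwartz function `t ↦ \overline{π(z) h_r (t)}`. -/
noncomputable def conjHermiteAtom (r : ℕ) (z : ℝ × ℝ) : 𝓢(ℝ, ℂ) where
  toFun := fun t => conj (tfShift z (hermiteFun r) t)
  smooth' := by
    obtain ⟨P, b, c, h⟩ := conj_tfShift_hermiteFun r z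
    rw [h]
    have h1 : ContDiff ℝ ∞ (fun t : ℝ => (t : ℂ)) := Complex.ofRealCLM.contDiff
    have h2 : ContDiff ℝ ∞ (fun s : ℂ => P.eval s) := by
      simpa using (P.contDiff_aeval (𝕜 := ℂ) ∞).restrict_scalars ℝ
    exact (h2.comp h1).mul (by fun_prop)
  decay' := by
    intro k n
    obtain ⟨P, b, c, h⟩ := conj_tfShift_hermiteFun r z
    rw [h]
    obtain ⟨Q, hQ⟩ := iteratedDeriv_complexGaussian n P (-Real.pi) b c
    obtain ⟨C, hC⟩ := bounded_complexGaussian (Polynomial.X ^ k * Q) b c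
    refine ⟨C, fun t => ?_⟩
    rw [norm_iteratedFDeriv_eq_norm_iteratedDeriv, hQ]
    refine le_trans (le_of_eq ?_) (hC t)
    simp [mul_assoc]

/-- The short-time Fourier transform `V_{h_r} f (z) = ⟨f, π(z) h_r⟩` of a tempered distribution
`f`. The sesquilinear pairing `⟨f, φ⟩` is the value of `f` at the Schwartz function
`\overline{φ}`. -/
noncomputable def distStft (r : ℕ) (f : 𝓢'(ℝ, ℂ)) (z : ℝ × ℝ) : ℂ :=
  f (conjHermiteAtom r z)

/-!
The whole argument takes place on the level of one entire function. The Hermite functions have the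
generating function `G_s(t) = 2^{1/4} e^{-π t² + 2 √π s t - s² / 2}`, that is,
`h_r = (r!)^{-1/2} (d/ds)^r G_s` at `s = 0`, and time-frequency shifts act on it in closed form: with
`u = (y, η)`, `v = √π (y + i η)` and `\overline{π(u)} φ (t) = e^{-2 π i t η} φ(t - y)`,
`\overline{π(u)} G_s = e^{-π i y η - |v|² / 2 - s v} G_{s + \bar{v}}`.
For a tempered distribution `f` and `z` in the plane, `E(τ) = f(\overline{π(z)} G_τ)` is entire
(`hasDerivAt_apply_gaussMonomial`, `differentiable_genTransform`), and derivatives in the parameter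
commute with `f` (`apply_eq_iteratedDeriv_gaussian`). Hence (`distStft_add`), up to an explicit phase
and the factor `(r!)^{-1/2} e^{-|v|² / 2}`, the value `V_{h_r} f (z + u)` is
`(d/ds)^r (e^{-s v} E(s + \bar{v}))` at `s = 0`. By the Leibniz rule this is a combination of the
functions `v^k E^{(r-k)}(\bar{v})`, and on the circle `|v| = ρ`, where `v = ρ² / \bar{v}`, Cauchy's
formula for derivatives evaluates their means. The mean over the circle is therefore
`L_r(ρ²) E^{(r)}(0)` (`integral_shiftedDeriv_circle`), and `E^{(r)}(0)` is `V_{h_r} f (z)` up to the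
normalization.

For `f = h_j` and `z = 0`, Rodrigues' formula and integration by parts give `E(τ) = τ^j / √(j!)`
(`genTransform_hermiteFun`), so that `V_{h_j} h_j (u)` is a phase times
`L_j(π |u|²) e^{-π |u|² / 2}` (`stft_hermiteFun_self`). By covariance (`stftKernel_add`) this
determines the kernel `K_{h_j}(z, z + u)`, whose phase cancels that of `V_{h_r} f (z + u)`. Polar
coordinates and the substitution `t = π ρ²` then yield the local reproducing formula with the
constant `∫ L_r L_j e^{-t}` over `[0, π R²]` (`integral_planeDisc_distStft_mul_stftKernel`). The
case `f = h_r`, `z = 0` of the formula identifies this constant with `C_{j,r}(R)`. Square integrable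
functions are tempered distributions, so that they need no separate argument.
-/


/-! ### Gaussians as Schwartz functions depending on a complex parameter -/

/-- The Schwartz function `t ↦ tⁿ e^{-π t² + b t}`, where `b` is a complex parameter. -/
noncomputable def gaussMonomial (n : ℕ) (b : ℂ) : 𝓢(ℝ, ℂ) where
  toFun := fun t => (t : ℂ) ^ n * Complex.exp (-Real.pi * (t : ℂ) ^ 2 + b * t)
  smooth' := by
    have h1 : ContDiff ℝ ∞ (fun t : ℝ => (t : ℂ)) := Complex.ofRealCLM.contDiff
    fun_prop
  decay' := by
    intro k l
    obtain ⟨Q, hQ⟩ := iteratedDeriv_complexGaussian l (Polynomial.X ^ n) (-Real.pi) b 0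
    obtain ⟨C, hC⟩ := bounded_complexGaussian (Polynomial.X ^ k * Q) b 0
    simp only [Polynomial.eval_pow, Polynomial.eval_X, add_zero] at hQ
    refine ⟨C, fun t => ?_⟩
    rw [norm_iteratedFDeriv_eq_norm_iteratedDeriv, hQ]
    refine le_trans (le_of_eq ?_) (hC t)
    simp [mul_assoc]

theorem gaussMonomial_apply (n : ℕ) (b : ℂ) (t : ℝ) :
    gaussMonomial n b t = (t : ℂ) ^ n * Complex.exp (-Real.pi * (t : ℂ) ^ 2 + b * t) := rfl

/-- The derivatives of `tⁿ e^{-π t² + b t}` decay so fast that a factor `e^{|t|}` is harmless. -/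
theorem exists_bound_gaussMonomial (n : ℕ) (b : ℂ) (k l : ℕ) :
    ∃ C : ℝ, 0 ≤ C ∧ ∀ t : ℝ, |t| ^ k * ‖iteratedDeriv l (gaussMonomial n b) t‖ *
      ((1 + t ^ 2) * Real.exp |t|) ≤ C := by
  obtain ⟨Q, hQ⟩ := iteratedDeriv_complexGaussian l (Polynomial.X ^ n) (-Real.pi) b 0
  simp only [Polynomial.eval_pow, Polynomial.eval_X, add_zero] at hQ
  obtain ⟨C, hC⟩ :=
    bounded_complexGaussian (Polynomial.X ^ k * (1 + Polynomial.X ^ 2) * Q) (b + 1) 0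
  obtain ⟨D, hD⟩ :=
    bounded_complexGaussian (Polynomial.X ^ k * (1 + Polynomial.X ^ 2) * Q) (b - 1) 0
  have key : ∀ (t : ℝ) (e : ℝ), |t| ^ k * ‖iteratedDeriv l (gaussMonomial n b) t‖ *
      ((1 + t ^ 2) * Real.exp (e * t)) =
      ‖(Polynomial.X ^ k * (1 + Polynomial.X ^ 2) * Q).eval (t : ℂ) *
        Complex.exp (-Real.pi * (t : ℂ) ^ 2 + (b + e) * t + 0)‖ := by
    intro t e
    have h1 : ‖(1 : ℂ) + (t : ℂ) ^ 2‖ = 1 + t ^ 2 := by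
      have : (1 : ℂ) + (t : ℂ) ^ 2 = ((1 + t ^ 2 : ℝ) : ℂ) := by push_cast; ring
      rw [this, Complex.norm_real, Real.norm_of_nonneg (by positivity)]
    have h2 : Complex.exp (-Real.pi * (t : ℂ) ^ 2 + (b + e) * t + 0) =
        Complex.exp (-Real.pi * (t : ℂ) ^ 2 + b * t) * ((Real.exp (e * t) : ℝ) : ℂ) := by
      rw [Complex.ofReal_exp, ← Complex.exp_add]; push_cast; ring_nf
    have h3 : iteratedDeriv l (gaussMonomial n b) t =
        Q.eval (t : ℂ) * Complex.exp (-Real.pi * (t : ℂ) ^ 2 + b * t) := hQ t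
    rw [h2, h3]
    simp only [Polynomial.eval_mul, Polynomial.eval_pow, Polynomial.eval_X, Polynomial.eval_add,
      Polynomial.eval_one, norm_mul, norm_pow, h1, Complex.norm_real, Real.norm_eq_abs,
      Real.abs_exp]
    ring
  have hC0 : 0 ≤ C := (norm_nonneg _).trans (hC 0)
  have hD0 : 0 ≤ D := (norm_nonneg _).trans (hD 0)
  refine ⟨max C D, le_max_of_le_left hC0, fun t => ?_⟩
  rcases le_total 0 t with ht | ht
  · have := key t 1
    rw [abs_of_nonneg ht] at this ⊢
    rw [one_mul] at this
    rw [this]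
    refine le_trans ?_ ((hC t).trans (le_max_left _ _))
    simp
  · have := key t (-1)
    rw [abs_of_nonpos ht] at this ⊢
    rw [neg_one_mul] at this
    rw [this]
    refine le_trans ?_ ((hD t).trans (le_max_right _ _))
    simp [sub_eq_add_neg]

theorem hasDerivAt_cexp_mul_ofReal (h : ℂ) (t : ℝ) :
    HasDerivAt (fun t : ℝ => Complex.exp (h * t)) (h * Complex.exp (h * t)) t := by
  have h0 : HasDerivAt (fun s : ℂ => h * s) h (t : ℂ) := by
    simpa using (hasDerivAt_id (t : ℂ)).const_mul h
  simpa [mul_comm] using h0.cexp.comp_ofReal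

/-- All derivatives of the error `h⁻¹ (e^{h t} - 1 - h t)` of the difference quotient of
`h ↦ e^{h t}` are `O(h)`, up to a factor that a Gaussian absorbs. -/
theorem norm_iteratedDeriv_expRemainder_le (h : ℂ) (h0 : h ≠ 0) (h1 : ‖h‖ ≤ 1) (m : ℕ) (t : ℝ) :
    ‖iteratedDeriv m (fun t : ℝ => h⁻¹ * (Complex.exp (h * t) - 1 - h * t)) t‖ ≤
      ‖h‖ * ((1 + t ^ 2) * Real.exp |t|) := by
  have hnt : ‖h * (t : ℂ)‖ ≤ |t| := by
    rw [norm_mul, Complex.norm_real, Real.norm_eq_abs]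
    exact mul_le_of_le_one_left (abs_nonneg t) h1
  have hexp : Real.exp ‖h * (t : ℂ)‖ ≤ Real.exp |t| := Real.exp_le_exp.2 hnt
  have hE : ‖Complex.exp (h * t)‖ ≤ Real.exp |t| := (Complex.norm_exp_le_exp_norm _).trans hexp
  have hd1 : ∀ t : ℝ, HasDerivAt (fun t : ℝ => h⁻¹ * (Complex.exp (h * t) - 1 - h * t))
      (Complex.exp (h * t) - 1) t := by
    intro t
    have h2 : HasDerivAt (fun t : ℝ => h * (t : ℂ)) h t := by
      simpa using ((hasDerivAt_id (t : ℂ)).const_mul h).comp_ofReal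
    refine ((((hasDerivAt_cexp_mul_ofReal h t).sub_const 1).sub h2).const_mul h⁻¹).congr_deriv ?_
    field_simp
  have hd2 : ∀ m : ℕ, iteratedDeriv (m + 2)
      (fun t : ℝ => h⁻¹ * (Complex.exp (h * t) - 1 - h * t)) =
      fun t : ℝ => h ^ (m + 1) * Complex.exp (h * t) := by
    intro m
    induction m with
    | zero =>
      rw [iteratedDeriv_succ, iteratedDeriv_one, funext fun t => (hd1 t).deriv]
      funext t
      simpa using ((hasDerivAt_cexp_mul_ofReal h t).sub_const 1).deriv
    | succ m ih =>
      rw [iteratedDeriv_succ, ih]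
      funext t
      refine ((hasDerivAt_cexp_mul_ofReal h t).const_mul _).deriv.trans ?_
      ring
  match m with
  | 0 =>
    have h3 := Complex.norm_exp_sub_sum_le_norm_mul_exp (h * t) 2
    have h4 : Complex.exp (h * t) - ∑ m ∈ Finset.range 2, (h * t) ^ m / m.factorial =
        Complex.exp (h * t) - 1 - h * t := by
      simp [Finset.sum_range_succ]; ring
    rw [h4] at h3
    rw [iteratedDeriv_zero, norm_mul, norm_inv, inv_mul_le_iff₀ (norm_pos_iff.2 h0)]
    refine h3.trans ?_
    rw [norm_mul, Complex.norm_real, Real.norm_eq_abs, mul_pow, sq_abs]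
    rw [norm_mul, Complex.norm_real, Real.norm_eq_abs] at hexp
    calc ‖h‖ ^ 2 * t ^ 2 * Real.exp (‖h‖ * |t|) ≤ ‖h‖ ^ 2 * (1 + t ^ 2) * Real.exp |t| := by
          gcongr; linarith
      _ = _ := by ring
  | 1 =>
    rw [iteratedDeriv_one, (hd1 t).deriv]
    have h3 := Complex.norm_exp_sub_sum_le_norm_mul_exp (h * t) 1
    have h4 : Complex.exp (h * t) - ∑ m ∈ Finset.range 1, (h * t) ^ m / m.factorial =
        Complex.exp (h * t) - 1 := by
      simp
    rw [h4] at h3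
    refine h3.trans ?_
    rw [norm_mul, Complex.norm_real, Real.norm_eq_abs, pow_one]
    rw [norm_mul, Complex.norm_real, Real.norm_eq_abs] at hexp
    have : |t| ≤ 1 + t ^ 2 := by nlinarith [sq_nonneg (|t| - 1), sq_abs t]
    calc ‖h‖ * |t| * Real.exp (‖h‖ * |t|) ≤ ‖h‖ * (1 + t ^ 2) * Real.exp |t| := by
          gcongr
      _ = _ := by ring
  | m + 2 =>
    rw [hd2, norm_mul, norm_pow]
    have h3 : ‖h‖ ^ (m + 1) ≤ ‖h‖ := by
      simpa using pow_le_pow_of_le_one (norm_nonneg h) h1 (Nat.le_add_left 1 m)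
    have h4 : Real.exp |t| ≤ (1 + t ^ 2) * Real.exp |t| :=
      le_mul_of_one_le_left (Real.exp_pos _).le (by nlinarith)
    gcongr
    exact hE.trans h4

/-- The difference quotients of `b ↦ tⁿ e^{-π t² + b t}` converge in every Schwartz seminorm, at
a linear rate. -/
theorem seminorm_gaussMonomial_slope_sub_le (n : ℕ) (b : ℂ) (k l : ℕ) :
    ∃ C : ℝ, ∀ h : ℂ, h ≠ 0 → ‖h‖ ≤ 1 →
      SchwartzMap.seminorm ℂ k l (h⁻¹ • (gaussMonomial n (b + h) - gaussMonomial n b) -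
        gaussMonomial (n + 1) b) ≤ C * ‖h‖ := by
  choose B hB0 hB using fun i => exists_bound_gaussMonomial n b k i
  refine ⟨∑ i ∈ Finset.range (l + 1), l.choose i * B i, fun h h0 h1 => ?_⟩
  have hsum : 0 ≤ ∑ i ∈ Finset.range (l + 1), l.choose i * B i :=
    Finset.sum_nonneg fun i _ => mul_nonneg (Nat.cast_nonneg _) (hB0 i)
  refine SchwartzMap.seminorm_le_bound' ℂ k l _ (mul_nonneg hsum (norm_nonneg h)) fun t => ?_
  have hfun : (⇑(h⁻¹ • (gaussMonomial n (b + h) - gaussMonomial n b) -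
        gaussMonomial (n + 1) b) : ℝ → ℂ) = fun t : ℝ =>
      gaussMonomial n b t * (h⁻¹ * (Complex.exp (h * t) - 1 - h * t)) := by
    funext t
    have : Complex.exp (-Real.pi * (t : ℂ) ^ 2 + (b + h) * t) =
        Complex.exp (-Real.pi * (t : ℂ) ^ 2 + b * t) * Complex.exp (h * t) := by
      rw [← Complex.exp_add]; ring_nf
    simp only [sub_apply, smul_apply, gaussMonomial_apply, this, smul_eq_mul]
    field_simp
    ring
  have hrem : ContDiff ℝ ∞ (fun t : ℝ => h⁻¹ * (Complex.exp (h * t) - 1 - h * t)) := by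
    have h1 : ContDiff ℝ ∞ (fun t : ℝ => (t : ℂ)) := Complex.ofRealCLM.contDiff
    fun_prop
  rw [hfun, iteratedDeriv_fun_mul (((gaussMonomial n b).smooth l).contDiffAt)
    ((hrem.of_le (by exact_mod_cast le_top)).contDiffAt)]
  refine (mul_le_mul_of_nonneg_left (norm_sum_le _ _) (by positivity)).trans ?_
  rw [Finset.mul_sum, Finset.sum_mul]
  refine Finset.sum_le_sum fun i _ => ?_
  rw [norm_mul, norm_mul, Complex.norm_natCast]
  calc |t| ^ k * (l.choose i * ‖iteratedDeriv i (gaussMonomial n b) t‖ *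
        ‖iteratedDeriv (l - i) (fun t : ℝ => h⁻¹ * (Complex.exp (h * t) - 1 - h * t)) t‖)
      ≤ |t| ^ k * (l.choose i * ‖iteratedDeriv i (gaussMonomial n b) t‖ *
        (‖h‖ * ((1 + t ^ 2) * Real.exp |t|))) := by
        gcongr
        exact norm_iteratedDeriv_expRemainder_le h h0 h1 _ t
    _ = l.choose i * (|t| ^ k * ‖iteratedDeriv i (gaussMonomial n b) t‖ *
        ((1 + t ^ 2) * Real.exp |t|)) * ‖h‖ := by ring
    _ ≤ l.choose i * B i * ‖h‖ := by
        gcongr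
        exact hB i t

/-- A tempered distribution, evaluated at Gaussians, is an entire function of the parameter. -/
theorem hasDerivAt_apply_gaussMonomial (f : 𝓢'(ℝ, ℂ)) (n : ℕ) (b : ℂ) :
    HasDerivAt (fun b => f (gaussMonomial n b)) (f (gaussMonomial (n + 1) b)) b := by
  rw [hasDerivAt_iff_tendsto_slope_zero]
  have hlim : Filter.Tendsto
      (fun h : ℂ => h⁻¹ • (gaussMonomial n (b + h) - gaussMonomial n b))
      (nhdsWithin 0 {0}ᶜ) (nhds (gaussMonomial (n + 1) b)) := by
    rw [(schwartz_withSeminorms ℂ ℝ ℂ).tendsto_nhds]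
    rintro ⟨k, l⟩ ε hε
    obtain ⟨C, hC⟩ := seminorm_gaussMonomial_slope_sub_le n b k l
    have hC1 : Filter.Tendsto (fun h : ℂ => C * ‖h‖) (nhdsWithin 0 {0}ᶜ) (nhds 0) := by
      have : Continuous fun h : ℂ => C * ‖h‖ := by fun_prop
      simpa using (this.tendsto 0).mono_left nhdsWithin_le_nhds
    have hball : ∀ᶠ h : ℂ in nhdsWithin 0 {0}ᶜ, ‖h‖ ≤ 1 := by
      refine nhdsWithin_le_nhds ?_
      filter_upwards [Metric.ball_mem_nhds (0 : ℂ) one_pos] with h hh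
      simpa using (mem_ball_zero_iff.1 hh).le
    filter_upwards [hball, hC1.eventually (gt_mem_nhds hε), self_mem_nhdsWithin] with h h1 h2 h3
    exact (hC h h3 h1).trans_lt h2
  have hf : Continuous f := map_continuous f
  refine ((hf.tendsto _).comp hlim).congr fun h => ?_
  simp

/-! ### Parameter derivatives commute with tempered distributions -/

theorem iteratedDeriv_apply_gaussMonomial (f : 𝓢'(ℝ, ℂ)) (n : ℕ) (b κ : ℂ) (m : ℕ) :
    iteratedDeriv m (fun s => f (gaussMonomial n (b + κ * s))) =
      fun s => κ ^ m * f (gaussMonomial (n + m) (b + κ * s)) := by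
  induction m with
  | zero => simp
  | succ m ih =>
    rw [iteratedDeriv_succ, ih]
    funext s
    have h0 : HasDerivAt (fun s : ℂ => b + κ * s) κ s := by
      simpa using ((hasDerivAt_id s).const_mul κ).const_add b
    refine (((hasDerivAt_apply_gaussMonomial f (n + m) (b + κ * s)).comp s h0).const_mul
      (κ ^ m)).deriv.trans ?_
    rw [pow_succ, ← add_assoc]
    ring

theorem differentiable_apply_gaussMonomial (f : 𝓢'(ℝ, ℂ)) (n : ℕ) :
    Differentiable ℂ fun b => f (gaussMonomial n b) :=
  fun b => (hasDerivAt_apply_gaussMonomial f n b).differentiableAt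

/-- If a Schwartz function `ψ` is pointwise the `m`-th derivative at `0`, with respect to a complex
parameter, of a family of Gaussians, then so is its image under a tempered distribution. By the
Leibniz rule `ψ` is a combination of the functions `gaussMonomial i b`, whose coefficients do not
depend on the distribution. -/
theorem apply_eq_iteratedDeriv_gaussian (f : 𝓢'(ℝ, ℂ)) {a : ℂ → ℂ} (ha : Differentiable ℂ a)
    (b κ : ℂ) (m : ℕ) (ψ : 𝓢(ℝ, ℂ))
    (hψ : ∀ t : ℝ, ψ t = iteratedDeriv m
      (fun s => a s * Complex.exp (-Real.pi * (t : ℂ) ^ 2 + (b + κ * s) * t)) 0) :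
    f ψ = iteratedDeriv m (fun s => a s * f (gaussMonomial 0 (b + κ * s))) 0 := by
  have key : ∀ g : 𝓢'(ℝ, ℂ),
      iteratedDeriv m (fun s => a s * g (gaussMonomial 0 (b + κ * s))) 0 =
      g (∑ i ∈ Finset.range (m + 1),
        (m.choose i * iteratedDeriv i a 0 * κ ^ (m - i)) • gaussMonomial (m - i) b) := by
    intro g
    have h1 : Differentiable ℂ fun s => g (gaussMonomial 0 (b + κ * s)) :=
      (differentiable_apply_gaussMonomial g 0).comp (by fun_prop)
    rw [iteratedDeriv_fun_mul ha.contDiff.contDiffAt h1.contDiff.contDiffAt, map_sum]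
    refine Finset.sum_congr rfl fun i _ => ?_
    rw [iteratedDeriv_apply_gaussMonomial, map_smul]
    simp
    ring
  have hsum : ψ = ∑ i ∈ Finset.range (m + 1),
        (m.choose i * iteratedDeriv i a 0 * κ ^ (m - i)) • gaussMonomial (m - i) b := by
    ext t
    -- evaluation at `t` is itself a tempered distribution
    rw [hψ t, ← TemperedDistribution.delta_apply t (∑ i ∈ _, _), ← key]
    simp [gaussMonomial_apply]
  rw [key, ← hsum]

/-! ### Laguerre polynomials -/

/-- The coefficient identity behind the three-term recurrence of the Laguerre polynomials. -/
theorem laguerre_coeff_recurrence (n k : ℕ) :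
    ((n + 2 : ℕ) : ℝ) * (n + 2).choose (k + 1) =
      (2 * (n + 1) + 1) * (n + 1).choose (k + 1) + (k + 1) * (n + 1).choose k -
        (n + 1) * n.choose (k + 1) := by
  have h1 : ((n + 2).choose (k + 1) : ℝ) = (n + 1).choose k + (n + 1).choose (k + 1) := by
    exact_mod_cast Nat.choose_succ_succ (n + 1) k
  have h2 : ((n + 1).choose (k + 1) : ℝ) = n.choose k + n.choose (k + 1) := by
    exact_mod_cast Nat.choose_succ_succ n k
  have h3 : ((n : ℝ) + 1) * n.choose k = (n + 1).choose (k + 1) * (k + 1) := by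
    exact_mod_cast Nat.add_one_mul_choose_eq n k
  have h4 : ((n + 1).choose (k + 1) : ℝ) * (k + 1) = (n + 1).choose k * (n + 1 - k) := by
    rcases le_or_gt k (n + 1) with h | h
    · have := Nat.choose_succ_right_eq (n + 1) k
      have h' : ((n + 1 - k : ℕ) : ℝ) = n + 1 - k := by rw [Nat.cast_sub h]; push_cast; ring
      rw [← h']
      exact_mod_cast this
    · rw [Nat.choose_eq_zero_of_lt h, Nat.choose_eq_zero_of_lt (by omega : n + 1 < k + 1)]
      simp
  rw [h1]
  push_cast
  linear_combination (-1 : ℝ) * h4 - (n + 1) * h2 - h3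

theorem laguerreFun_zero_eq_sum_of_lt (x : ℝ) (N n : ℕ) (hn : n < N) :
    laguerreFun 0 n x =
      ∑ k ∈ Finset.range N, (n.choose k : ℝ) * ((-x) ^ k / k.factorial) := by
  induction n using Nat.strong_induction_on with
  | _ n ih =>
  match n, ih, hn with
  | 0, _, hn =>
    obtain ⟨M, rfl⟩ : ∃ M, N = M + 1 := ⟨N - 1, by omega⟩
    rw [Finset.sum_range_succ']
    simp [laguerreFun]
  | 1, _, hn =>
    obtain ⟨M, rfl⟩ : ∃ M, N = M + 2 := ⟨N - 2, by omega⟩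
    rw [Finset.sum_range_succ', Finset.sum_range_succ']
    have : ∀ i : ℕ, Nat.choose 1 (i + 1 + 1) = 0 := fun i =>
      Nat.choose_eq_zero_of_lt (by omega)
    simp [laguerreFun, this]
    ring
  | n + 2, ih, hn =>
    obtain ⟨M, rfl⟩ : ∃ M, N = M + 1 := ⟨N - 1, by omega⟩
    have e1 := ih (n + 1) (by omega) (by omega)
    have e0 := ih n (by omega) (by omega)
    -- multiplication by `-x` shifts the coefficients; the top one vanishes
    have hx : -x * ∑ k ∈ Finset.range (M + 1), ((n + 1).choose k : ℝ) * ((-x) ^ k / k.factorial) =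
        ∑ k ∈ Finset.range M, (k + 1) * ((n + 1).choose k : ℝ) *
          ((-x) ^ (k + 1) / (k + 1).factorial) := by
      rw [Finset.sum_range_succ, Nat.choose_eq_zero_of_lt (by omega : n + 1 < M), Nat.cast_zero,
        zero_mul, add_zero, Finset.mul_sum]
      refine Finset.sum_congr rfl fun k _ => ?_
      rw [Nat.factorial_succ]
      push_cast
      field_simp
      ring
    have hrec : ((n + 2 : ℕ) : ℝ) * laguerreFun 0 (n + 2) x =
        (2 * (n + 1) + 1) * laguerreFun 0 (n + 1) x + -x * laguerreFun 0 (n + 1) x -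
          (n + 1) * laguerreFun 0 n x := by
      rw [laguerreFun]
      push_cast
      field_simp
      ring
    have hne : ((n + 2 : ℕ) : ℝ) ≠ 0 := by positivity
    refine mul_left_cancel₀ hne ?_
    rw [hrec, e1, e0, hx, Finset.sum_range_succ', Finset.sum_range_succ', Finset.sum_range_succ']
    have hterm : ∀ k : ℕ, ((n + 2 : ℕ) : ℝ) *
        (((n + 2).choose (k + 1) : ℝ) * ((-x) ^ (k + 1) / (k + 1).factorial)) =
        (2 * (n + 1) + 1) * (((n + 1).choose (k + 1) : ℝ) * ((-x) ^ (k + 1) / (k + 1).factorial)) +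
        (k + 1) * ((n + 1).choose k : ℝ) * ((-x) ^ (k + 1) / (k + 1).factorial) -
        (n + 1) * ((n.choose (k + 1) : ℝ) * ((-x) ^ (k + 1) / (k + 1).factorial)) := by
      intro k
      linear_combination ((-x) ^ (k + 1) / (k + 1).factorial) * laguerre_coeff_recurrence n k
    rw [mul_add _ (∑ k ∈ Finset.range M, ((n + 2).choose (k + 1) : ℝ) * _), Finset.mul_sum,
      Finset.sum_congr rfl fun k _ => hterm k, Finset.sum_sub_distrib, Finset.sum_add_distrib,
      ← Finset.mul_sum, ← Finset.mul_sum]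
    simp
    ring

/-- The explicit form `L_n(x) = ∑ₖ (n choose k) (-x)ᵏ / k!`. -/
theorem laguerreFun_zero_eq_sum (n : ℕ) (x : ℝ) :
    laguerreFun 0 n x =
      ∑ k ∈ Finset.range (n + 1), (n.choose k : ℝ) * ((-x) ^ k / k.factorial) :=
  laguerreFun_zero_eq_sum_of_lt x (n + 1) n n.lt_succ_self

theorem continuous_laguerreFun_zero (n : ℕ) : Continuous (laguerreFun 0 n) := by
  rw [funext (laguerreFun_zero_eq_sum n)]
  fun_prop

theorem laguerreFun_zero_apply_zero (n : ℕ) : laguerreFun 0 n 0 = 1 := by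
  rw [laguerreFun_zero_eq_sum, Finset.sum_range_succ']
  simp

/-! ### Circular means of shifted derivatives of entire functions -/

/-- For entire `g`, Cauchy's formula for derivatives reads off the mean of `\bar{w}ᵏ g(w)` over
a circle about `0`, since `\bar{w} = ρ² / w` there. -/
theorem integral_conj_pow_mul_circleMap {g : ℂ → ℂ} (hg : Differentiable ℂ g) {ρ : ℝ} (hρ : 0 < ρ)
    (k : ℕ) :
    ∫ θ in (0 : ℝ)..(2 * Real.pi), conj (circleMap 0 ρ θ) ^ k * g (circleMap 0 ρ θ) =
      2 * Real.pi * ((ρ ^ 2) ^ k / k.factorial) * iteratedDeriv k g 0 := by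
  have h := hg.differentiableOn (s := Metric.closedBall 0 ρ)
    |>.circleIntegral_one_div_sub_center_pow_smul hρ k
  rw [circleIntegral] at h
  have hpt : ∀ θ : ℝ, conj (circleMap 0 ρ θ) ^ k * g (circleMap 0 ρ θ) =
      ((ρ : ℂ) ^ 2) ^ k / Complex.I * (deriv (circleMap 0 ρ) θ •
        ((1 / (circleMap 0 ρ θ - 0) ^ (k + 1)) • g (circleMap 0 ρ θ))) := by
    intro θ
    have hw : circleMap 0 ρ θ ≠ 0 := circleMap_ne_center hρ.ne'
    have hc : conj (circleMap 0 ρ θ) = (ρ : ℂ) ^ 2 / circleMap 0 ρ θ := by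
      rw [eq_div_iff hw, mul_comm, Complex.mul_conj, Complex.normSq_eq_norm_sq, norm_circleMap_zero,
        sq_abs]
      push_cast
      ring
    rw [hc, deriv_circleMap, sub_zero, smul_eq_mul, smul_eq_mul, div_pow]
    have := Complex.I_ne_zero
    field_simp
    ring
  simp_rw [hpt]
  rw [intervalIntegral.integral_const_mul, h, smul_eq_mul]
  have := Complex.I_ne_zero
  field_simp

/-- The value `(d/ds)^r (e^{-s v} E(s + \bar{v}))` at `s = 0`, for an entire function `E`. For
`E(s) = ⟨f, G_s⟩`, where `G_s` is the generating function of the Hermite functions, this is the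
short-time Fourier transform of `f` at `v`, up to elementary factors. -/
noncomputable def shiftedDeriv (r : ℕ) (E : ℂ → ℂ) (v : ℂ) : ℂ :=
  iteratedDeriv r (fun s => Complex.exp (-s * v) * E (s + conj v)) 0

theorem shiftedDeriv_eq_sum (r : ℕ) {E : ℂ → ℂ} (hE : Differentiable ℂ E) (v : ℂ) :
    shiftedDeriv r E v = ∑ k ∈ Finset.range (r + 1),
      r.choose k * (-v) ^ k * iteratedDeriv (r - k) E (conj v) := by
  have h1 : Differentiable ℂ fun s : ℂ => Complex.exp (-s * v) := by fun_prop
  have h2 : Differentiable ℂ fun s : ℂ => E (s + conj v) := hE.comp (by fun_prop)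
  rw [shiftedDeriv, iteratedDeriv_fun_mul h1.contDiff.contDiffAt h2.contDiff.contDiffAt]
  refine Finset.sum_congr rfl fun k _ => ?_
  have h3 : (fun s : ℂ => Complex.exp (-s * v)) = fun s => Complex.exp (-v * s) := by
    funext s; ring_nf
  rw [iteratedDeriv_comp_add_const, h3, iteratedDeriv_cexp_const_mul]
  simp

theorem shiftedDeriv_zero (r : ℕ) (E : ℂ → ℂ) : shiftedDeriv r E 0 = iteratedDeriv r E 0 := by
  simp [shiftedDeriv]

theorem differentiable_iteratedDeriv {E : ℂ → ℂ} (hE : Differentiable ℂ E) (n : ℕ) :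
    Differentiable ℂ (iteratedDeriv n E) :=
  hE.contDiff.differentiable_iteratedDeriv' n

theorem continuous_shiftedDeriv (r : ℕ) {E : ℂ → ℂ} (hE : Differentiable ℂ E) :
    Continuous (shiftedDeriv r E) := by
  rw [funext (shiftedDeriv_eq_sum r hE)]
  refine continuous_finsetSum _ fun k _ => ?_
  exact (by fun_prop : Continuous fun v : ℂ => (r.choose k : ℂ) * (-v) ^ k).mul
    ((differentiable_iteratedDeriv hE (r - k)).continuous.comp Complex.continuous_conj)

/-- The circular means of `shiftedDeriv r E` are the values of a Laguerre polynomial. -/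
theorem integral_shiftedDeriv_circle (r : ℕ) {E : ℂ → ℂ} (hE : Differentiable ℂ E) {ρ : ℝ}
    (hρ : 0 < ρ) :
    ∫ θ in (-Real.pi)..Real.pi, shiftedDeriv r E (circleMap 0 ρ θ) =
      2 * Real.pi * (laguerreFun 0 r (ρ ^ 2) : ℝ) * iteratedDeriv r E 0 := by
  have hconj : ∀ θ : ℝ, conj (circleMap 0 ρ θ) = circleMap 0 ρ (-θ) := by
    intro θ
    simp [circleMap, ← Complex.exp_conj]
  -- the reflection `θ ↦ -θ` turns `\bar{v}` into the variable of the Cauchy integral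
  have hper : Function.Periodic (fun θ => shiftedDeriv r E (conj (circleMap 0 ρ θ)))
      (2 * Real.pi) := fun θ => by
    simp only [periodic_circleMap 0 ρ θ]
  have h1 : ∫ θ in (-Real.pi)..Real.pi, shiftedDeriv r E (circleMap 0 ρ θ) =
      ∫ θ in (0 : ℝ)..(2 * Real.pi), shiftedDeriv r E (conj (circleMap 0 ρ θ)) := by
    have := hper.intervalIntegral_add_eq (-Real.pi) 0
    rw [zero_add, show -Real.pi + 2 * Real.pi = Real.pi by ring] at this
    rw [← this]
    simp_rw [hconj]
    rw [intervalIntegral.integral_comp_neg (fun θ => shiftedDeriv r E (circleMap 0 ρ θ)), neg_neg]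
  rw [h1]
  simp_rw [shiftedDeriv_eq_sum r hE, Complex.conj_conj]
  have hcirc : Continuous (circleMap 0 ρ) := continuous_circleMap 0 ρ
  rw [intervalIntegral.integral_finsetSum fun k _ => ?_]
  · rw [laguerreFun_zero_eq_sum]
    push_cast
    rw [Finset.mul_sum, Finset.sum_mul]
    refine Finset.sum_congr rfl fun k hk => ?_
    have hk' : k ≤ r := by simpa [Nat.lt_succ_iff] using hk
    have h2 : ∀ θ : ℝ, (r.choose k : ℂ) * (-conj (circleMap 0 ρ θ)) ^ k *
        iteratedDeriv (r - k) E (circleMap 0 ρ θ) = (r.choose k * (-1) ^ k) *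
        (conj (circleMap 0 ρ θ) ^ k * iteratedDeriv (r - k) E (circleMap 0 ρ θ)) := by
      intro θ
      rw [neg_pow]
      ring
    simp_rw [h2]
    rw [intervalIntegral.integral_const_mul,
      integral_conj_pow_mul_circleMap (differentiable_iteratedDeriv hE _) hρ]
    have h3 : iteratedDeriv k (iteratedDeriv (r - k) E) = iteratedDeriv r E := by
      rw [iteratedDeriv_eq_iterate, iteratedDeriv_eq_iterate, iteratedDeriv_eq_iterate,
        ← Function.iterate_add_apply, Nat.add_sub_cancel' hk']
    rw [h3, neg_pow ((ρ : ℂ) ^ 2)]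
    ring
  · refine Continuous.intervalIntegrable ?_ _ _
    exact (by fun_prop : Continuous fun θ : ℝ =>
      (r.choose k : ℂ) * (-conj (circleMap 0 ρ θ)) ^ k).mul
        ((differentiable_iteratedDeriv hE (r - k)).continuous.comp hcirc)

/-! ### The generating function of the Hermite functions -/

theorem ofReal_iteratedDeriv_gaussian (r : ℕ) (a : ℝ) (t : ℝ) :
    ((iteratedDeriv r (fun s : ℝ => Real.exp (a * s ^ 2)) t : ℝ) : ℂ) =
      iteratedDeriv r (fun s : ℂ => Complex.exp (a * s ^ 2)) t := by
  induction r generalizing t with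
  | zero => simp
  | succ r ih =>
    have h1 : ContDiff ℝ ∞ (fun s : ℝ => Real.exp (a * s ^ 2)) := by fun_prop
    have h2 : Differentiable ℂ (fun s : ℂ => Complex.exp (a * s ^ 2)) := by fun_prop
    have h3 := ((h1.differentiable_iteratedDeriv r (by exact_mod_cast WithTop.coe_lt_top r))
      t).hasDerivAt.ofReal_comp
    have h4 := (differentiable_iteratedDeriv h2 r (t : ℂ)).hasDerivAt.comp_ofReal
    rw [iteratedDeriv_succ, iteratedDeriv_succ]
    refine h3.unique (h4.congr_of_eventuallyEq (Filter.Eventually.of_forall ih))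

/-- The square root `√π`, as a complex number, squares to `π`. -/
theorem ofReal_sqrt_pi_sq : ((√Real.pi : ℝ) : ℂ) ^ 2 = (Real.pi : ℂ) := by
  rw [← Complex.ofReal_pow, Real.sq_sqrt Real.pi_pos.le]

theorem ofReal_sqrt_pi_ne_zero : ((√Real.pi : ℝ) : ℂ) ≠ 0 :=
  Complex.ofReal_ne_zero.2 (Real.sqrt_pos.2 Real.pi_pos).ne'

/-- The function `G_s(t) = 2^{1/4} e^{-π t² + 2 √π s t - s² / 2}` generates the Hermite functions:
`G_s = ∑ᵣ h_r sʳ / √(r!)`. -/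
theorem hermiteFun_eq_iteratedDeriv (r : ℕ) (t : ℝ) :
    hermiteFun r t = ((√(r.factorial : ℝ) : ℝ) : ℂ)⁻¹ *
      iteratedDeriv r (fun s : ℂ => (((2 : ℝ) ^ (1 / 4 : ℝ) : ℝ) : ℂ) *
        Complex.exp (-Real.pi * (t : ℂ) ^ 2 + 2 * √Real.pi * s * t - s ^ 2 / 2)) 0 := by
  have hp := ofReal_sqrt_pi_sq
  have hp0 := ofReal_sqrt_pi_ne_zero
  have hfun : (fun s : ℂ => (((2 : ℝ) ^ (1 / 4 : ℝ) : ℝ) : ℂ) *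
        Complex.exp (-Real.pi * (t : ℂ) ^ 2 + 2 * √Real.pi * s * t - s ^ 2 / 2)) =
      fun s : ℂ => ((((2 : ℝ) ^ (1 / 4 : ℝ) : ℝ) : ℂ) * Complex.exp (Real.pi * (t : ℂ) ^ 2)) *
        (fun y : ℂ => (fun x : ℂ => Complex.exp ((-2 * Real.pi : ℝ) * x ^ 2)) (t + y))
          ((-1 / (2 * √Real.pi)) * s) := by
    funext s
    have he : Complex.exp (-Real.pi * (t : ℂ) ^ 2 + 2 * √Real.pi * s * t - s ^ 2 / 2) =
        Complex.exp (Real.pi * (t : ℂ) ^ 2) *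
          Complex.exp ((-2 * Real.pi : ℝ) * (t + (-1 / (2 * √Real.pi)) * s) ^ 2) := by
      rw [← Complex.exp_add]
      congr 1
      push_cast
      rw [← hp]
      field_simp
      ring
    rw [he]
    exact (mul_assoc _ _ _).symm
  have hd : ContDiff ℂ r (fun y : ℂ =>
      (fun x : ℂ => Complex.exp ((-2 * Real.pi : ℝ) * x ^ 2)) (t + y)) := by fun_prop
  rw [hfun, iteratedDeriv_const_mul_field, iteratedDeriv_comp_const_mul hd,
    iteratedDeriv_comp_const_add r (fun x : ℂ => Complex.exp ((-2 * Real.pi : ℝ) * x ^ 2))]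
  simp only [mul_zero, add_zero]
  rw [← ofReal_iteratedDeriv_gaussian, hermiteFun, hermiteReal]
  push_cast
  ring

/-! ### The short-time Fourier transform through an entire function -/

/-- The point `√π (y + i η)` of the complex plane that belongs to `u = (y, η)`. -/
noncomputable def phasePoint (u : ℝ × ℝ) : ℂ := √Real.pi * (u.1 + Complex.I * u.2)

/-- The Bargmann-type transform `τ ↦ f(\overline{π(z)} G_τ)` of a tempered distribution `f`, where
`G_τ` is the generating function of the Hermite functions and
`\overline{π(z)} φ (t) = e^{-2 π i t ξ} φ(t - x)` for `z = (x, ξ)`. -/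
noncomputable def genTransform (f : 𝓢'(ℝ, ℂ)) (z : ℝ × ℝ) (τ : ℂ) : ℂ :=
  ((((2 : ℝ) ^ (1 / 4 : ℝ) : ℝ) : ℂ) *
    Complex.exp (-Real.pi * (z.1 : ℂ) ^ 2 - 2 * √Real.pi * τ * z.1 - τ ^ 2 / 2)) *
    f (gaussMonomial 0 (2 * Real.pi * (z.1 - Complex.I * z.2) + 2 * √Real.pi * τ))

theorem differentiable_genTransform (f : 𝓢'(ℝ, ℂ)) (z : ℝ × ℝ) :
    Differentiable ℂ (genTransform f z) := by
  have h1 : Differentiable ℂ fun τ : ℂ =>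
      f (gaussMonomial 0 (2 * Real.pi * (z.1 - Complex.I * z.2) + 2 * √Real.pi * τ)) :=
    (differentiable_apply_gaussMonomial f 0).comp (by fun_prop)
  exact Differentiable.mul (by fun_prop) h1

theorem conj_tfShift_hermiteFun_eq (w : ℝ × ℝ) (r : ℕ) (t : ℝ) :
    conj (tfShift w (hermiteFun r) t) =
      Complex.exp (-(2 * Real.pi * Complex.I * t * w.2)) * hermiteFun r (t - w.1) := by
  rw [tfShift, hermiteFun, map_mul, Complex.conj_ofReal, ← Complex.exp_conj]
  simp [Complex.conj_ofNat]

/-- The transform of `f` near `z` in terms of the entire function `genTransform f z`: the operators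
`\overline{π(u)}` act on the generating function by
`\overline{π(u)} G_s = e^{-π i y η - |v|² / 2 - s v} G_{s + \bar{v}}`, with `v = √π (y + i η)`. -/
theorem distStft_add (r : ℕ) (f : 𝓢'(ℝ, ℂ)) (z u : ℝ × ℝ) :
    distStft r f (z + u) =
      (((√(r.factorial : ℝ) : ℝ) : ℂ)⁻¹ *
        Complex.exp (-2 * Real.pi * Complex.I * z.1 * u.2 - Real.pi * Complex.I * u.1 * u.2 -
          Real.pi * ((u.1 : ℂ) ^ 2 + (u.2 : ℂ) ^ 2) / 2)) *
        shiftedDeriv r (genTransform f z) (phasePoint u) := by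
  have hp := ofReal_sqrt_pi_sq
  set v := phasePoint u with hv
  have hvc : conj v = √Real.pi * (u.1 - Complex.I * u.2) := by
    simp [hv, phasePoint, sub_eq_add_neg]
  rw [phasePoint] at hv
  set K : ℂ := ((√(r.factorial : ℝ) : ℝ) : ℂ)⁻¹ *
        Complex.exp (-2 * Real.pi * Complex.I * z.1 * u.2 - Real.pi * Complex.I * u.1 * u.2 -
          Real.pi * ((u.1 : ℂ) ^ 2 + (u.2 : ℂ) ^ 2) / 2) with hK
  set a : ℂ → ℂ := fun s => K * (Complex.exp (-s * v) * ((((2 : ℝ) ^ (1 / 4 : ℝ) : ℝ) : ℂ) *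
    Complex.exp (-Real.pi * (z.1 : ℂ) ^ 2 - 2 * √Real.pi * (s + conj v) * z.1 -
      (s + conj v) ^ 2 / 2))) with ha
  have haD : Differentiable ℂ a := by fun_prop
  rw [distStft, apply_eq_iteratedDeriv_gaussian f haD
    (2 * Real.pi * (z.1 - Complex.I * z.2) + 2 * √Real.pi * conj v) (2 * √Real.pi) r,
    shiftedDeriv, ← iteratedDeriv_const_mul_field]
  · congr 1
    funext s
    rw [genTransform, ha]
    simp only
    have : 2 * (Real.pi : ℂ) * (z.1 - Complex.I * z.2) + 2 * √Real.pi * (s + conj v) =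
      2 * Real.pi * (z.1 - Complex.I * z.2) + 2 * √Real.pi * conj v + 2 * √Real.pi * s := by ring
    rw [this]
    ring
  · intro t
    change conj (tfShift (z + u) (hermiteFun r) t) = _
    rw [conj_tfShift_hermiteFun_eq, hermiteFun_eq_iteratedDeriv, mul_left_comm,
      ← iteratedDeriv_const_mul_field, ← iteratedDeriv_const_mul_field]
    congr 1
    funext s
    rw [ha, hK]
    simp only
    -- the action of the time-frequency shift by `z + u` on the generating function
    have hexp : Complex.exp (-(2 * Real.pi * Complex.I * t * ((z + u).2 : ℝ))) *
        Complex.exp (-Real.pi * ((t - (z + u).1 : ℝ) : ℂ) ^ 2 +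
          2 * √Real.pi * s * ((t - (z + u).1 : ℝ) : ℂ) - s ^ 2 / 2) =
        Complex.exp (-2 * Real.pi * Complex.I * z.1 * u.2 - Real.pi * Complex.I * u.1 * u.2 -
          Real.pi * ((u.1 : ℂ) ^ 2 + (u.2 : ℂ) ^ 2) / 2) * Complex.exp (-s * v) *
        Complex.exp (-Real.pi * (z.1 : ℂ) ^ 2 - 2 * √Real.pi * (s + conj v) * z.1 -
          (s + conj v) ^ 2 / 2) *
        Complex.exp (-Real.pi * (t : ℂ) ^ 2 + (2 * Real.pi * (z.1 - Complex.I * z.2) +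
          2 * √Real.pi * conj v + 2 * √Real.pi * s) * t) := by
      simp only [← Complex.exp_add]
      congr 1
      rw [hvc, hv, ← hp, Prod.fst_add, Prod.snd_add]
      push_cast
      linear_combination ((√Real.pi : ℂ) ^ 2 * (u.2 : ℂ) ^ 2 / 2) * Complex.I_sq
    linear_combination (((√(r.factorial : ℝ) : ℝ) : ℂ)⁻¹ * (((2 : ℝ) ^ (1 / 4 : ℝ) : ℝ) : ℂ)) * hexp

theorem distStft_eq_iteratedDeriv (r : ℕ) (f : 𝓢'(ℝ, ℂ)) (z : ℝ × ℝ) :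
    distStft r f z = ((√(r.factorial : ℝ) : ℝ) : ℂ)⁻¹ * iteratedDeriv r (genTransform f z) 0 := by
  have h := distStft_add r f z 0
  simpa [phasePoint, shiftedDeriv_zero] using h

theorem continuous_phasePoint : Continuous phasePoint := by
  unfold phasePoint
  fun_prop

theorem continuous_distStft (r : ℕ) (f : 𝓢'(ℝ, ℂ)) : Continuous (distStft r f) := by
  have h := funext (distStft_add r f 0)
  simp only [zero_add] at h
  change Continuous fun u => distStft r f u
  rw [h]
  exact Continuous.mul (by fun_prop)
    ((continuous_shiftedDeriv r (differentiable_genTransform f 0)).comp continuous_phasePoint)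

/-! ### Square integrable functions as tempered distributions -/

theorem exists_temperedDistribution_stft (r : ℕ) {f : ℝ → ℂ} (hf : MemLp f 2) :
    ∃ F : 𝓢'(ℝ, ℂ), (∀ φ : 𝓢(ℝ, ℂ), F φ = ∫ t, φ t * f t) ∧
      ∀ w, stft (hermiteFun r) f w = distStft r F w := by
  have hF : ∀ φ : 𝓢(ℝ, ℂ), Lp.toTemperedDistribution (hf.toLp f) φ = ∫ t, φ t * f t := by
    intro φ
    rw [Lp.toTemperedDistribution_apply]
    refine integral_congr_ae ?_
    filter_upwards [hf.coeFn_toLp] with t ht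
    rw [ht, smul_eq_mul]
  refine ⟨Lp.toTemperedDistribution (hf.toLp f), hF, fun w => ?_⟩
  rw [distStft, hF, stft, l2Pairing]
  exact integral_congr_ae (Filter.Eventually.of_forall fun t => mul_comm _ _)

theorem memLp_hermiteFun (j : ℕ) : MemLp (hermiteFun j) 2 := by
  have h : (conjHermiteAtom j 0 : ℝ → ℂ) = hermiteFun j := by
    funext t
    change conj (tfShift 0 (hermiteFun j) t) = _
    simp [conj_tfShift_hermiteFun_eq]
  rw [← h]
  exact (conjHermiteAtom j 0).memLp 2

/-! ### The short-time Fourier transform of a Hermite function with the same window -/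

theorem integrable_iteratedDeriv_gaussian_mul_cexp (j : ℕ) (b : ℂ) :
    Integrable fun t : ℝ =>
      ((iteratedDeriv j (fun s : ℝ => Real.exp (-2 * Real.pi * s ^ 2)) t : ℝ) : ℂ) *
        Complex.exp (b * t) := by
  obtain ⟨Q, hQ⟩ := iteratedDeriv_realGaussian j (-2 * Real.pi)
  obtain ⟨C, hC⟩ := bounded_complexGaussian (Q.map Complex.ofRealHom) b 0
  have hg : Integrable fun t : ℝ => Complex.exp (-Real.pi * (t : ℂ) ^ 2 + 0 * t + 0) :=
    integrable_cexp_quadratic' (by simpa using Real.pi_pos) 0 0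
  have hbd := hg.bdd_mul (c := C) (f := fun t : ℝ => (Q.map Complex.ofRealHom).eval (t : ℂ) *
    Complex.exp (-Real.pi * (t : ℂ) ^ 2 + b * t + 0))
    (by
      refine Continuous.aestronglyMeasurable ?_
      exact ((Q.map Complex.ofRealHom).continuous.comp Complex.continuous_ofReal).mul
        (by fun_prop)) (Filter.Eventually.of_forall hC)
  refine hbd.congr (Filter.Eventually.of_forall fun t => ?_)
  have hq : (Q.map Complex.ofRealHom).eval (t : ℂ) = ((Q.eval t : ℝ) : ℂ) :=
    Polynomial.eval_map_apply (p := Q) (f := Complex.ofRealHom) t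
  simp only [hQ, hq]
  push_cast
  rw [mul_assoc, mul_assoc, ← Complex.exp_add, ← Complex.exp_add]
  ring_nf

/-- The two-sided Laplace transform of the `j`-th derivative of the Gaussian `e^{-2 π t²}`. -/
theorem integral_iteratedDeriv_gaussian_mul_cexp (j : ℕ) (b : ℂ) :
    ∫ t : ℝ, ((iteratedDeriv j (fun s : ℝ => Real.exp (-2 * Real.pi * s ^ 2)) t : ℝ) : ℂ) *
        Complex.exp (b * t) = (-b) ^ j * (((√2 : ℝ) : ℂ)⁻¹ * Complex.exp (b ^ 2 / (8 * Real.pi))) := by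
  induction j with
  | zero =>
    have h := integral_cexp_quadratic (b := -2 * Real.pi) (by simpa using Real.pi_pos) b 0
    have h2 : ((Real.pi : ℂ) / -(-2 * Real.pi)) ^ (1 / 2 : ℂ) = ((√2 : ℝ) : ℂ)⁻¹ := by
      have hpi : (Real.pi : ℂ) ≠ 0 := Complex.ofReal_ne_zero.2 Real.pi_ne_zero
      have e1 : (Real.pi : ℂ) / -(-2 * Real.pi) = (((2 : ℝ)⁻¹ : ℝ) : ℂ) := by
        push_cast
        field_simp
      have e2 : (1 / 2 : ℂ) = ((1 / 2 : ℝ) : ℂ) := by push_cast; ring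
      rw [e1, e2, ← Complex.ofReal_cpow (by positivity), ← Real.sqrt_eq_rpow, Real.sqrt_inv]
      push_cast
      ring
    rw [h2] at h
    have h3 : (0 : ℂ) - b ^ 2 / (4 * (-2 * Real.pi)) = b ^ 2 / (8 * Real.pi) := by
      have hpi : (Real.pi : ℂ) ≠ 0 := Complex.ofReal_ne_zero.2 Real.pi_ne_zero
      field_simp
      ring
    rw [h3] at h
    rw [pow_zero, one_mul, ← h]
    refine integral_congr_ae (Filter.Eventually.of_forall fun t => ?_)
    simp only [iteratedDeriv_zero]
    push_cast
    rw [← Complex.exp_add, add_zero]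
  | succ j ih =>
    have hsm : ContDiff ℝ ∞ (fun s : ℝ => Real.exp (-2 * Real.pi * s ^ 2)) := by fun_prop
    have hd : ∀ t : ℝ, HasDerivAt (fun t : ℝ =>
        ((iteratedDeriv j (fun s : ℝ => Real.exp (-2 * Real.pi * s ^ 2)) t : ℝ) : ℂ) *
          Complex.exp (b * t))
        (((iteratedDeriv (j + 1) (fun s : ℝ => Real.exp (-2 * Real.pi * s ^ 2)) t : ℝ) : ℂ) *
          Complex.exp (b * t) + b *
          (((iteratedDeriv j (fun s : ℝ => Real.exp (-2 * Real.pi * s ^ 2)) t : ℝ) : ℂ) *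
          Complex.exp (b * t))) t := by
      intro t
      have h1 := ((hsm.differentiable_iteratedDeriv j (by exact_mod_cast WithTop.coe_lt_top j))
        t).hasDerivAt.ofReal_comp
      rw [← iteratedDeriv_succ] at h1
      exact (h1.mul (hasDerivAt_cexp_mul_ofReal b t)).congr_deriv (by ring)
    have hi := integrable_iteratedDeriv_gaussian_mul_cexp j b
    have hi' := integrable_iteratedDeriv_gaussian_mul_cexp (j + 1) b
    -- integration by parts without boundary terms
    have h0 := integral_eq_zero_of_hasDerivAt_of_integrable hd (hi'.add (hi.const_mul b)) hi
    rw [integral_add hi' (hi.const_mul b), integral_const_mul, ih] at h0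
    rw [pow_succ]
    linear_combination h0

/-- The Bargmann transform of `h_j` is the normalized monomial of degree `j`. -/
theorem genTransform_hermiteFun (j : ℕ) (F : 𝓢'(ℝ, ℂ))
    (hF : ∀ φ : 𝓢(ℝ, ℂ), F φ = ∫ t, φ t * hermiteFun j t) (τ : ℂ) :
    genTransform F 0 τ = ((√(j.factorial : ℝ) : ℝ) : ℂ)⁻¹ * τ ^ j := by
  have hp := ofReal_sqrt_pi_sq
  have hp0 := ofReal_sqrt_pi_ne_zero
  rw [genTransform, hF]
  have hint : ∀ t : ℝ, gaussMonomial 0 (2 * Real.pi * (((0 : ℝ × ℝ).1 : ℝ) -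
      Complex.I * ((0 : ℝ × ℝ).2 : ℝ)) + 2 * √Real.pi * τ) t * hermiteFun j t =
      ((((2 : ℝ) ^ (1 / 4 : ℝ) : ℝ) : ℂ) * ((√(j.factorial : ℝ) : ℝ) : ℂ)⁻¹ *
        (-1 / (2 * √Real.pi)) ^ j) *
      (((iteratedDeriv j (fun s : ℝ => Real.exp (-2 * Real.pi * s ^ 2)) t : ℝ) : ℂ) *
        Complex.exp ((2 * √Real.pi * τ) * t)) := by
    intro t
    have he : Complex.exp (-Real.pi * (t : ℂ) ^ 2 + (2 * √Real.pi * τ) * t) *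
        Complex.exp (Real.pi * (t : ℂ) ^ 2) = Complex.exp ((2 * √Real.pi * τ) * t) := by
      rw [← Complex.exp_add]
      ring_nf
    rw [gaussMonomial_apply, hermiteFun, hermiteReal, ← he]
    simp only [Prod.fst_zero, Prod.snd_zero]
    push_cast
    ring_nf
  simp_rw [hint]
  rw [integral_const_mul, integral_iteratedDeriv_gaussian_mul_cexp]
  -- the constants of `G_τ` and `h_j` cancel the value `2^{-1/2}` of the Gaussian integral
  have h4 : (((2 : ℝ) ^ (1 / 4 : ℝ) : ℝ) : ℂ) * (((2 : ℝ) ^ (1 / 4 : ℝ) : ℝ) : ℂ) =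
      ((√2 : ℝ) : ℂ) := by
    rw [← Complex.ofReal_mul, ← Real.rpow_add (by norm_num), Real.sqrt_eq_rpow]
    norm_num
  have h2 : ((√2 : ℝ) : ℂ) ≠ 0 := Complex.ofReal_ne_zero.2 (by positivity)
  have h5 : (2 * √Real.pi * τ) ^ 2 / (8 * Real.pi) = τ ^ 2 / 2 := by
    rw [← hp]
    field_simp
    ring
  have h6 : (-1 / (2 * (√Real.pi : ℂ))) ^ j * (-(2 * √Real.pi * τ)) ^ j = τ ^ j := by
    rw [← mul_pow]
    congr 1
    field_simp
  have h7 : Complex.exp (-Real.pi * (((0 : ℝ × ℝ).1 : ℝ) : ℂ) ^ 2 -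
      2 * √Real.pi * τ * ((0 : ℝ × ℝ).1 : ℝ) - τ ^ 2 / 2) * Complex.exp (τ ^ 2 / 2) = 1 := by
    rw [← Complex.exp_add]
    simp
  rw [h5]
  calc _ = ((((2 : ℝ) ^ (1 / 4 : ℝ) : ℝ) : ℂ) * (((2 : ℝ) ^ (1 / 4 : ℝ) : ℝ) : ℂ)) *
        ((√2 : ℝ) : ℂ)⁻¹ * ((√(j.factorial : ℝ) : ℝ) : ℂ)⁻¹ *
        ((-1 / (2 * (√Real.pi : ℂ))) ^ j * (-(2 * √Real.pi * τ)) ^ j) *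
        (Complex.exp (-Real.pi * (((0 : ℝ × ℝ).1 : ℝ) : ℂ) ^ 2 -
      2 * √Real.pi * τ * ((0 : ℝ × ℝ).1 : ℝ) - τ ^ 2 / 2) * Complex.exp (τ ^ 2 / 2)) := by ring
    _ = _ := by rw [h4, h6, h7, mul_inv_cancel₀ h2]; ring

theorem shiftedDeriv_pow (j : ℕ) (v : ℂ) :
    shiftedDeriv j (fun τ => τ ^ j) v = j.factorial * (laguerreFun 0 j (‖v‖ ^ 2) : ℝ) := by
  rw [shiftedDeriv_eq_sum j (by fun_prop), laguerreFun_zero_eq_sum]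
  push_cast
  rw [Finset.mul_sum]
  refine Finset.sum_congr rfl fun k hk => ?_
  have hk' : k ≤ j := by simpa [Nat.lt_succ_iff] using hk
  have h1 : (k.factorial : ℂ) * j.descFactorial (j - k) = j.factorial := by
    have := Nat.factorial_mul_descFactorial (Nat.sub_le j k)
    rw [Nat.sub_sub_self hk'] at this
    exact_mod_cast this
  have h2 : -(‖v‖ : ℂ) ^ 2 = -v * conj v := by
    rw [neg_mul, Complex.mul_conj']
  have h3 : (k.factorial : ℂ) ≠ 0 := by exact_mod_cast k.factorial_ne_zero
  rw [iteratedDeriv_pow, Nat.sub_sub_self hk', h2, mul_pow, ← h1]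
  field_simp

theorem norm_phasePoint_sq (u : ℝ × ℝ) : ‖phasePoint u‖ ^ 2 = Real.pi * (u.1 ^ 2 + u.2 ^ 2) := by
  rw [phasePoint, norm_mul, mul_pow, Complex.norm_real, Real.norm_eq_abs, sq_abs,
    Real.sq_sqrt Real.pi_pos.le, ← Complex.normSq_eq_norm_sq, Complex.normSq_apply]
  simp
  ring

/-- Up to a phase, the transform of `h_j` with window `h_j` is a Laguerre function of `π |u|²`. -/
theorem stft_hermiteFun_self (j : ℕ) (u : ℝ × ℝ) :
    stft (hermiteFun j) (hermiteFun j) u =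
      Complex.exp (-Real.pi * Complex.I * u.1 * u.2) *
        ((laguerreFun 0 j (Real.pi * (u.1 ^ 2 + u.2 ^ 2)) *
          Real.exp (-(Real.pi * (u.1 ^ 2 + u.2 ^ 2)) / 2) : ℝ) : ℂ) := by
  obtain ⟨F, hF, hst⟩ := exists_temperedDistribution_stft j (memLp_hermiteFun j)
  have h := distStft_add j F 0 u
  have hgen : genTransform F 0 = fun τ => ((√(j.factorial : ℝ) : ℝ) : ℂ)⁻¹ * τ ^ j :=
    funext (genTransform_hermiteFun j F hF)
  have hsd : shiftedDeriv j (genTransform F 0) (phasePoint u) =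
      ((√(j.factorial : ℝ) : ℝ) : ℂ)⁻¹ * shiftedDeriv j (fun τ => τ ^ j) (phasePoint u) := by
    rw [hgen, shiftedDeriv, shiftedDeriv, ← iteratedDeriv_const_mul_field]
    congr 1
    funext s
    ring
  have hfac : ((√(j.factorial : ℝ) : ℝ) : ℂ)⁻¹ * ((√(j.factorial : ℝ) : ℝ) : ℂ)⁻¹ * j.factorial =
      1 := by
    have h1 : ((√(j.factorial : ℝ) : ℝ) : ℂ) * ((√(j.factorial : ℝ) : ℝ) : ℂ) = j.factorial := by
      rw [← Complex.ofReal_mul, Real.mul_self_sqrt (by positivity)]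
      simp
    have h2 : (j.factorial : ℂ) ≠ 0 := by exact_mod_cast j.factorial_ne_zero
    rw [← mul_inv, h1, inv_mul_cancel₀ h2]
  have he : Complex.exp (-2 * Real.pi * Complex.I * ((0 : ℝ × ℝ).1 : ℝ) * u.2 -
      Real.pi * Complex.I * u.1 * u.2 - Real.pi * ((u.1 : ℂ) ^ 2 + (u.2 : ℂ) ^ 2) / 2) =
      Complex.exp (-Real.pi * Complex.I * u.1 * u.2) *
        ((Real.exp (-(Real.pi * (u.1 ^ 2 + u.2 ^ 2)) / 2) : ℝ) : ℂ) := by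
    rw [Complex.ofReal_exp, ← Complex.exp_add]
    congr 1
    simp
    ring
  rw [zero_add] at h
  rw [hst, h, hsd, shiftedDeriv_pow, norm_phasePoint_sq, he]
  push_cast
  linear_combination (Complex.exp (-Real.pi * Complex.I * u.1 * u.2) *
    Complex.exp (-(Real.pi * ((u.1 : ℂ) ^ 2 + (u.2 : ℂ) ^ 2)) / 2) *
    (laguerreFun 0 j (Real.pi * (u.1 ^ 2 + u.2 ^ 2)) : ℝ)) * hfac

/-- The reproducing kernel near `z`, by covariance under time-frequency shifts. -/
theorem stftKernel_add (g : ℝ → ℂ) (z u : ℝ × ℝ) :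
    stftKernel g z (z + u) =
      Complex.exp (2 * Real.pi * Complex.I * z.1 * u.2) * conj (stft g g u) := by
  have h1 : ∀ t : ℝ, conj (Complex.exp (2 * Real.pi * Complex.I * t * z.2)) =
      Complex.exp (-(2 * Real.pi * Complex.I * t * z.2)) := by
    intro t
    rw [← Complex.exp_conj]
    simp [Complex.conj_ofNat]
  rw [stftKernel, l2Pairing, stft, l2Pairing, ← integral_conj, ← integral_const_mul,
    ← integral_sub_right_eq_self (fun t : ℝ =>
      Complex.exp (2 * Real.pi * Complex.I * z.1 * u.2) * conj (g t * conj (tfShift u g t))) z.1]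
  refine integral_congr_ae (Filter.Eventually.of_forall fun t => ?_)
  simp only [tfShift, map_mul, Complex.conj_conj, h1, Prod.fst_add, Prod.snd_add]
  have h2 : Complex.exp (2 * Real.pi * Complex.I * t * ((z.2 + u.2 : ℝ) : ℂ)) *
      Complex.exp (-(2 * Real.pi * Complex.I * t * z.2)) =
      Complex.exp (2 * Real.pi * Complex.I * z.1 * u.2) *
        Complex.exp (2 * Real.pi * Complex.I * ((t - z.1 : ℝ) : ℂ) * u.2) := by
    rw [← Complex.exp_add, ← Complex.exp_add]
    congr 1
    push_cast
    ring
  rw [sub_sub]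
  linear_combination (g (t - (z.1 + u.1)) * conj (g (t - z.1))) * h2

/-! ### Integration over discs in polar coordinates -/

theorem measurableSet_planeDisc (z : ℝ × ℝ) (R : ℝ) : MeasurableSet (planeDisc z R) :=
  measurableSet_lt (by fun_prop) measurable_const

theorem integrableOn_planeDisc {F : ℝ × ℝ → ℂ} (hF : Continuous F) (z : ℝ × ℝ) {R : ℝ}
    (hR : 0 < R) : IntegrableOn F (planeDisc z R) := by
  have hsub : planeDisc z R ⊆ Metric.closedBall z R := by
    intro w hw
    have hw' : (w.1 - z.1) ^ 2 + (w.2 - z.2) ^ 2 < R ^ 2 := hw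
    rw [Metric.mem_closedBall, Prod.dist_eq, Real.dist_eq, Real.dist_eq]
    refine max_le (abs_le_of_sq_le_sq ?_ hR.le) (abs_le_of_sq_le_sq ?_ hR.le) <;>
      nlinarith [sq_nonneg (w.1 - z.1), sq_nonneg (w.2 - z.2)]
  exact (hF.continuousOn.integrableOn_compact (isCompact_closedBall z R)).mono_set hsub

theorem integral_planeDisc_eq_integral_polar {F : ℝ × ℝ → ℂ} (hF : Continuous F) (z : ℝ × ℝ)
    {R : ℝ} (hR : 0 < R) :
    ∫ w in planeDisc z R, F w = ∫ ρ in (0 : ℝ)..R, (ρ : ℂ) *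
      ∫ θ in (-Real.pi)..Real.pi, F (z + (ρ * Real.cos θ, ρ * Real.sin θ)) := by
  have htrans : ∫ w in planeDisc z R, F w = ∫ u in planeDisc 0 R, F (z + u) := by
    rw [← integral_indicator (measurableSet_planeDisc z R),
      ← integral_indicator (measurableSet_planeDisc 0 R), ← integral_add_left_eq_self _ z]
    refine integral_congr_ae (Filter.Eventually.of_forall fun u => ?_)
    simp [indicator, planeDisc]
  have hpolar : ∀ p : ℝ × ℝ, polarCoord.symm p = (p.1 * Real.cos p.2, p.1 * Real.sin p.2) :=
    fun p => rfl
  have hpc : Continuous fun p : ℝ × ℝ =>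
      p.1 • F (z + (p.1 * Real.cos p.2, p.1 * Real.sin p.2)) := by fun_prop
  have hint : IntegrableOn (fun p : ℝ × ℝ =>
      p.1 • F (z + (p.1 * Real.cos p.2, p.1 * Real.sin p.2)))
      (Ioo 0 R ×ˢ Ioo (-Real.pi) Real.pi) (volume.prod volume) := by
    rw [← Measure.volume_eq_prod]
    exact (hpc.continuousOn.integrableOn_compact (isCompact_Icc.prod isCompact_Icc)).mono_set
      (prod_mono Ioo_subset_Icc_self Ioo_subset_Icc_self)
  have htarget : ∀ p ∈ polarCoord.target,
      p.1 • (planeDisc 0 R).indicator (fun u => F (z + u)) (polarCoord.symm p) =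
      (Ioo 0 R ×ˢ Ioo (-Real.pi) Real.pi).indicator (fun p : ℝ × ℝ =>
        p.1 • F (z + (p.1 * Real.cos p.2, p.1 * Real.sin p.2))) p := by
    rintro ⟨ρ, θ⟩ ⟨hρ, hθ⟩
    have hρ' : 0 < ρ := hρ
    have hiff : (ρ * Real.cos θ, ρ * Real.sin θ) ∈ planeDisc 0 R ↔ ρ < R := by
      have : (ρ * Real.cos θ - 0) ^ 2 + (ρ * Real.sin θ - 0) ^ 2 = ρ ^ 2 := by
        linear_combination ρ ^ 2 * Real.sin_sq_add_cos_sq θ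
      change (ρ * Real.cos θ - 0) ^ 2 + (ρ * Real.sin θ - 0) ^ 2 < R ^ 2 ↔ _
      rw [this, sq_lt_sq₀ hρ'.le hR.le]
    rw [hpolar]
    by_cases h : ρ < R
    · have hmem : (ρ, θ) ∈ Ioo 0 R ×ˢ Ioo (-Real.pi) Real.pi := ⟨⟨hρ', h⟩, hθ⟩
      rw [indicator_of_mem (hiff.2 h), indicator_of_mem hmem]
    · rw [indicator_of_notMem (fun h' => h (hiff.1 h')), smul_zero,
        indicator_of_notMem (fun h' => h h'.1.2)]
  have hsub : Ioo 0 R ×ˢ Ioo (-Real.pi) Real.pi ⊆ polarCoord.target :=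
    prod_mono (fun ρ hρ => hρ.1) subset_rfl
  rw [htrans, ← integral_indicator (measurableSet_planeDisc 0 R),
    ← integral_comp_polarCoord_symm,
    setIntegral_congr_fun polarCoord.open_target.measurableSet htarget,
    setIntegral_indicator (measurableSet_Ioo.prod measurableSet_Ioo),
    inter_eq_self_of_subset_right hsub, Measure.volume_eq_prod, setIntegral_prod _ hint,
    intervalIntegral.integral_of_le hR.le, integral_Ioc_eq_integral_Ioo]
  refine integral_congr_ae (Filter.Eventually.of_forall fun ρ => ?_)
  simp only
  rw [intervalIntegral.integral_of_le (by linarith [Real.pi_pos]), integral_Ioc_eq_integral_Ioo,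
    ← integral_const_mul]
  exact integral_congr_ae (Filter.Eventually.of_forall fun θ => Complex.real_smul)

/-! ### The local reproducing formula -/

theorem phasePoint_polar (ρ θ : ℝ) :
    phasePoint (ρ * Real.cos θ, ρ * Real.sin θ) = circleMap 0 (√Real.pi * ρ) θ := by
  rw [phasePoint, circleMap, Complex.exp_mul_I]
  push_cast
  ring

/-- The phases of the transform and of the kernel cancel. -/
theorem distStft_mul_stftKernel_add (r j : ℕ) (f : 𝓢'(ℝ, ℂ)) (z u : ℝ × ℝ) :
    distStft r f (z + u) * stftKernel (hermiteFun j) z (z + u) =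
      (((√(r.factorial : ℝ) : ℝ) : ℂ)⁻¹ *
        ((laguerreFun 0 j (Real.pi * (u.1 ^ 2 + u.2 ^ 2)) *
          Real.exp (-(Real.pi * (u.1 ^ 2 + u.2 ^ 2))) : ℝ) : ℂ)) *
        shiftedDeriv r (genTransform f z) (phasePoint u) := by
  have hconj : conj (Complex.exp (-Real.pi * Complex.I * u.1 * u.2)) =
      Complex.exp (Real.pi * Complex.I * u.1 * u.2) := by
    rw [← Complex.exp_conj]
    simp
  rw [distStft_add, stftKernel_add, stft_hermiteFun_self, map_mul, Complex.conj_ofReal, hconj]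
  have he : Complex.exp (-2 * Real.pi * Complex.I * z.1 * u.2 - Real.pi * Complex.I * u.1 * u.2 -
        Real.pi * ((u.1 : ℂ) ^ 2 + (u.2 : ℂ) ^ 2) / 2) *
      Complex.exp (2 * Real.pi * Complex.I * z.1 * u.2) *
      Complex.exp (Real.pi * Complex.I * u.1 * u.2) *
      ((Real.exp (-(Real.pi * (u.1 ^ 2 + u.2 ^ 2)) / 2) : ℝ) : ℂ) =
      ((Real.exp (-(Real.pi * (u.1 ^ 2 + u.2 ^ 2))) : ℝ) : ℂ) := by
    rw [Complex.ofReal_exp, Complex.ofReal_exp]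
    simp only [← Complex.exp_add]
    congr 1
    push_cast
    ring
  rw [Complex.ofReal_mul, Complex.ofReal_mul, ← he]
  ring

theorem continuous_stftKernel_hermiteFun (j : ℕ) (z : ℝ × ℝ) :
    Continuous (stftKernel (hermiteFun j) z) := by
  have h : ∀ w, stftKernel (hermiteFun j) z w =
      Complex.exp (2 * Real.pi * Complex.I * z.1 * (w - z).2) *
        conj (stft (hermiteFun j) (hermiteFun j) (w - z)) := by
    intro w
    rw [← stftKernel_add, add_sub_cancel]
  have hlag := continuous_laguerreFun_zero j
  change Continuous fun w => stftKernel (hermiteFun j) z w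
  simp_rw [h, stft_hermiteFun_self]
  fun_prop

/-- The substitution `t = π ρ²`. -/
theorem integral_laguerre_radial (r j : ℕ) (R : ℝ) :
    ∫ ρ in (0 : ℝ)..R, laguerreFun 0 r (Real.pi * ρ ^ 2) * laguerreFun 0 j (Real.pi * ρ ^ 2) *
        Real.exp (-(Real.pi * ρ ^ 2)) * (2 * Real.pi * ρ) =
      ∫ t in (0 : ℝ)..(Real.pi * R ^ 2),
        laguerreFun 0 r t * laguerreFun 0 j t * Real.exp (-t) := by
  have hr := continuous_laguerreFun_zero r
  have hj := continuous_laguerreFun_zero j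
  have hd : ∀ ρ ∈ uIcc 0 R, HasDerivAt (fun ρ : ℝ => Real.pi * ρ ^ 2) (2 * Real.pi * ρ) ρ := by
    intro ρ _
    refine ((hasDerivAt_pow 2 ρ).const_mul Real.pi).congr_deriv ?_
    simp
    ring
  have h := intervalIntegral.integral_comp_mul_deriv
    (g := fun t => laguerreFun 0 r t * laguerreFun 0 j t * Real.exp (-t)) hd
    (by fun_prop) (by fun_prop)
  simpa using h

/-- The local reproducing formula, with the constant in its Laguerre form. -/
theorem integral_planeDisc_distStft_mul_stftKernel (r j : ℕ) (f : 𝓢'(ℝ, ℂ)) (z : ℝ × ℝ) {R : ℝ}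
    (hR : 0 < R) :
    ∫ w in planeDisc z R, distStft r f w * stftKernel (hermiteFun j) z w =
      ((∫ t in (0 : ℝ)..(Real.pi * R ^ 2),
        laguerreFun 0 r t * laguerreFun 0 j t * Real.exp (-t) : ℝ) : ℂ) * distStft r f z := by
  have hcont : Continuous fun w => distStft r f w * stftKernel (hermiteFun j) z w :=
    (continuous_distStft r f).mul (continuous_stftKernel_hermiteFun j z)
  rw [integral_planeDisc_eq_integral_polar hcont z hR, ← integral_laguerre_radial,
    ← intervalIntegral.integral_ofReal, ← intervalIntegral.integral_mul_const,
    distStft_eq_iteratedDeriv]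
  refine intervalIntegral.integral_congr_uIoo fun ρ hρ => ?_
  rw [uIoo_of_le hR.le] at hρ
  have hsq : ∀ θ : ℝ, (ρ * Real.cos θ) ^ 2 + (ρ * Real.sin θ) ^ 2 = ρ ^ 2 := fun θ => by
    linear_combination ρ ^ 2 * Real.sin_sq_add_cos_sq θ
  simp_rw [distStft_mul_stftKernel_add, hsq, phasePoint_polar]
  rw [intervalIntegral.integral_const_mul, integral_shiftedDeriv_circle r
    (differentiable_genTransform f z) (mul_pos (Real.sqrt_pos.2 Real.pi_pos) hρ.1), mul_pow,
    Real.sq_sqrt Real.pi_pos.le]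
  push_cast
  ring

theorem integrableOn_distStft_mul_stftKernel (r j : ℕ) (f : 𝓢'(ℝ, ℂ)) (z : ℝ × ℝ) {R : ℝ}
    (hR : 0 < R) :
    IntegrableOn (fun w => distStft r f w * stftKernel (hermiteFun j) z w) (planeDisc z R) :=
  integrableOn_planeDisc
    ((continuous_distStft r f).mul (continuous_stftKernel_hermiteFun j z)) z hR

theorem indicator_stft_mul_conj (r j : ℕ) (R : ℝ) :
    (fun w => (planeDisc 0 R).indicator (stft (hermiteFun r) (hermiteFun r)) w *
        conj (stft (hermiteFun j) (hermiteFun j) w)) =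
      (planeDisc 0 R).indicator fun w =>
        stft (hermiteFun r) (hermiteFun r) w * stftKernel (hermiteFun j) 0 w := by
  funext w
  have h := stftKernel_add (hermiteFun j) 0 w
  rw [zero_add] at h
  rw [indicator_mul_left, h]
  simp

/-- The constant `C_{j,r}(R)` is the local reproducing formula for `f = h_r` at `z = 0`. -/
theorem localConst_eq_integral_laguerre (r j : ℕ) {R : ℝ} (hR : 0 < R) :
    localConst j r R = ((∫ t in (0 : ℝ)..(Real.pi * R ^ 2),
      laguerreFun 0 r t * laguerreFun 0 j t * Real.exp (-t) : ℝ) : ℂ) := by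
  obtain ⟨F, -, hst⟩ := exists_temperedDistribution_stft r (memLp_hermiteFun r)
  have h0 : distStft r F 0 = 1 := by
    rw [← hst, stft_hermiteFun_self]
    simp [laguerreFun_zero_apply_zero]
  rw [localConst, indicator_stft_mul_conj, integral_indicator (measurableSet_planeDisc 0 R)]
  simp_rw [hst]
  rw [integral_planeDisc_distStft_mul_stftKernel r j F 0 hR, h0, mul_one]

theorem integral_laguerre_sq_pos (r : ℕ) {R : ℝ} (hR : 0 < R) :
    0 < ∫ t in (0 : ℝ)..(Real.pi * R ^ 2),
      laguerreFun 0 r t * laguerreFun 0 r t * Real.exp (-t) := by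
  have hr := continuous_laguerreFun_zero r
  have hpos : 0 < Real.pi * R ^ 2 := by positivity
  refine intervalIntegral.integral_pos hpos (by fun_prop)
    (fun t _ => mul_nonneg (mul_self_nonneg _) (Real.exp_pos _).le) ⟨0, ⟨le_rfl, hpos.le⟩, ?_⟩
  simp [laguerreFun_zero_apply_zero]

theorem theorem4p2 (R : ℝ) (hR : 0 < R) (r j : ℕ) :
    -- the two expressions for the constant agree
    (Integrable (fun w => (planeDisc 0 R).indicator (stft (hermiteFun r) (hermiteFun r)) w *
        conj (stft (hermiteFun j) (hermiteFun j) w)) ∧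
      localConst j r R =
        ((∫ t in (0 : ℝ)..(Real.pi * R ^ 2),
          laguerreFun 0 r t * laguerreFun 0 j t * Real.exp (-t) : ℝ) : ℂ)) ∧
    -- for equal indices the constant never vanishes
    (j = r → localConst j r R ≠ 0) ∧
    -- the local reproducing formula for square integrable functions
    (∀ f : ℝ → ℂ, MemLp f 2 → ∀ z : ℝ × ℝ,
      IntegrableOn (fun w => stft (hermiteFun r) f w * stftKernel (hermiteFun j) z w)
        (planeDisc z R) ∧
      localConst j r R * stft (hermiteFun r) f z =
        ∫ w in planeDisc z R, stft (hermiteFun r) f w * stftKernel (hermiteFun j) z w ∧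
      (localConst j r R ≠ 0 → stft (hermiteFun r) f z =
        (localConst j r R)⁻¹ *
          ∫ w in planeDisc z R, stft (hermiteFun r) f w * stftKernel (hermiteFun j) z w)) ∧
    -- the local reproducing formula for tempered distributions
    (∀ f : 𝓢'(ℝ, ℂ), ∀ z : ℝ × ℝ,
      IntegrableOn (fun w => distStft r f w * stftKernel (hermiteFun j) z w)
        (planeDisc z R) ∧
      localConst j r R * distStft r f z =
        ∫ w in planeDisc z R, distStft r f w * stftKernel (hermiteFun j) z w ∧
      (localConst j r R ≠ 0 → distStft r f z =
        (localConst j r R)⁻¹ *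
          ∫ w in planeDisc z R, distStft r f w * stftKernel (hermiteFun j) z w)) := by
  have hconst := localConst_eq_integral_laguerre r j hR
  have hdist : ∀ f : 𝓢'(ℝ, ℂ), ∀ z : ℝ × ℝ,
      IntegrableOn (fun w => distStft r f w * stftKernel (hermiteFun j) z w)
        (planeDisc z R) ∧
      localConst j r R * distStft r f z =
        ∫ w in planeDisc z R, distStft r f w * stftKernel (hermiteFun j) z w ∧
      (localConst j r R ≠ 0 → distStft r f z =
        (localConst j r R)⁻¹ *
          ∫ w in planeDisc z R, distStft r f w * stftKernel (hermiteFun j) z w) := by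
    intro f z
    have h := integral_planeDisc_distStft_mul_stftKernel r j f z hR
    rw [← hconst] at h
    exact ⟨integrableOn_distStft_mul_stftKernel r j f z hR, h.symm,
      fun hne => by rw [h, inv_mul_cancel_left₀ hne]⟩
  refine ⟨⟨?_, hconst⟩, ?_, ?_, hdist⟩
  · obtain ⟨F, -, hst⟩ := exists_temperedDistribution_stft r (memLp_hermiteFun r)
    rw [indicator_stft_mul_conj, integrable_indicator_iff (measurableSet_planeDisc 0 R)]
    simp_rw [hst]
    exact (hdist F 0).1
  · rintro rfl
    rw [hconst]
    exact Complex.ofReal_ne_zero.2 (integral_laguerre_sq_pos _ hR).ne'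
  · intro f hf z
    obtain ⟨F, -, hst⟩ := exists_temperedDistribution_stft r hf
    simp_rw [hst]
    exact hdist F z
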